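/- Let $R$ be a prime ring (associative, not necessarily unital), with center $Z(R)$ and extended centroid $C$, the center of the symmetric Martindale ring of quotients $Q_s(R)\supseteq R$. A Lie ideal of $R$ is an additive subgroup $L$ with $ar-ra\in L$ for all $a\in L$, $r\in R$; it is noncentral if $L\not\subseteq Z(R)$. For additive subgroups $A,B$ of $R$ (or of $Q_s(R)$), $AB$ denotes the additive subgroup generated by all products $ab$ with $a\in A$, $b\in B$. Let $K_1,\ldots,K_m$ be noncentral Lie ideals of $R$, where $m\ge 2$. Then $K_1K_2\cdots K_m$ contains a nonzero (two-sided) ideal of $R$ except precisely when $$K_1C=K_jC=Ca+C\qquad\text{for all } 1\le j\le m \text{ and all } a\in K_1\setminus Z(R);$$ that is, if this condition fails then $K_1K_2\cdots K_m$ contains a nonzero ideal of $R$, and if it holds then $K_1K_2\cdots K_m$ contains no nonzero ideal of $R$. -/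

import Mathlib

/-- A (nonzero, associative, not necessarily unital) ring is prime if `a R b = 0` forces `a = 0`
or `b = 0`. -/
class IsPrimeRing (R : Type*) [NonUnitalRing R] : Prop extends Nontrivial R where
  eq_zero_or_eq_zero : ∀ a b : R, (∀ r : R, a * r * b = 0) → a = 0 ∨ b = 0

/-- An additive subgroup `L` of `R` is a Lie ideal if `[L, R] ⊆ L`. -/
def IsLieIdeal {R : Type*} [NonUnitalRing R] (L : AddSubgroup R) : Prop :=
  ∀ a ∈ L, ∀ r : R, a * r - r * a ∈ L

/-- A Lie ideal (more generally, an additive subgroup) is central if it lies in the center. -/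
def IsCentral {R : Type*} [NonUnitalRing R] (L : AddSubgroup R) : Prop :=
  ∀ a ∈ L, a ∈ Set.center R

open scoped Pointwise in
/-- The product `K 0 * K 1 * ⋯ * K n` of additive subgroups of a ring; here `A * B` is the additive
subgroup generated by all `a * b` with `a ∈ A` and `b ∈ B`. -/
def lieProd {R : Type*} [NonUnitalRing R] :
    (n : ℕ) → (Fin (n + 1) → AddSubgroup R) → AddSubgroup R
  | 0, K => K 0
  | n + 1, K => lieProd n (fun i => K i.castSucc) * K (Fin.last (n + 1))

/-! ### The Martindale rings of quotients of a prime ring -/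

namespace Martindale

section Ideals

variable {R : Type*} [NonUnitalRing R]

/-- The product of two two-sided ideals. -/
def idealMul (I J : TwoSidedIdeal R) : TwoSidedIdeal R :=
  TwoSidedIdeal.span {z | ∃ x ∈ I, ∃ y ∈ J, z = x * y}

theorem idealMul_induction {I J : TwoSidedIdeal R} {p : R → Prop}
    (hmul : ∀ x ∈ I, ∀ y ∈ J, p (x * y)) (h0 : p 0)
    (hadd : ∀ x ∈ idealMul I J, ∀ y ∈ idealMul I J, p x → p y → p (x + y))
    (hneg : ∀ x ∈ idealMul I J, p x → p (-x))
    {z : R} (hz : z ∈ idealMul I J) : p z := by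
  have key : ∀ w : R, w ∈ idealMul I J ↔
      w ∈ AddSubgroup.closure {z : R | ∃ x ∈ I, ∃ y ∈ J, z = x * y} := fun w =>
    TwoSidedIdeal.mem_span_iff_mem_addSubgroup_closure_absorbing (by
      rintro a _ ⟨x, hx, y, hy, rfl⟩
      exact ⟨a * x, I.mul_mem_left _ _ hx, y, hy, by rw [mul_assoc]⟩) (by
      rintro _ a ⟨x, hx, y, hy, rfl⟩
      exact ⟨x, hx, y * a, J.mul_mem_right _ _ hy, by rw [mul_assoc]⟩)
  have hz' := (key z).1 hz
  induction hz' using AddSubgroup.closure_induction with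
  | mem w hw => obtain ⟨x, hx, y, hy, rfl⟩ := hw; exact hmul x hx y hy
  | zero => exact h0
  | add x y hx hy ihx ihy =>
    exact hadd x ((key x).2 hx) y ((key y).2 hy) (ihx ((key x).2 hx)) (ihy ((key y).2 hy))
  | neg x hx ihx => exact hneg x ((key x).2 hx) (ihx ((key x).2 hx))

theorem idealMul_le_left (I J : TwoSidedIdeal R) : idealMul I J ≤ I := fun _ hz =>
  idealMul_induction (p := fun z => z ∈ I) (fun _ hx _ _ => I.mul_mem_right _ _ hx) I.zero_mem
    (fun _ _ _ _ hx hy => I.add_mem hx hy) (fun _ _ hx => I.neg_mem hx) hz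

theorem idealMul_le_right (I J : TwoSidedIdeal R) : idealMul I J ≤ J := fun _ hz =>
  idealMul_induction (p := fun z => z ∈ J) (fun _ _ _ hy => J.mul_mem_left _ _ hy) J.zero_mem
    (fun _ _ _ _ hx hy => J.add_mem hx hy) (fun _ _ hx => J.neg_mem hx) hz

theorem exists_ne_zero {I : TwoSidedIdeal R} (hI : I ≠ ⊥) : ∃ x ∈ I, x ≠ 0 := by
  by_contra! h
  refine hI (le_antisymm (fun x hx => ?_) bot_le)
  exact (TwoSidedIdeal.mem_bot R).2 (h x hx)

theorem ne_bot_of_mem {I : TwoSidedIdeal R} {x : R} (hx : x ∈ I) (h0 : x ≠ 0) : I ≠ ⊥ := by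
  rintro rfl
  exact h0 ((TwoSidedIdeal.mem_bot R).1 hx)

variable [IsPrimeRing R]

theorem idealMul_ne_bot {I J : TwoSidedIdeal R} (hI : I ≠ ⊥) (hJ : J ≠ ⊥) :
    idealMul I J ≠ ⊥ := by
  obtain ⟨x, hx, hx0⟩ := exists_ne_zero hI
  obtain ⟨y, hy, hy0⟩ := exists_ne_zero hJ
  obtain ⟨r, hr⟩ : ∃ r : R, x * r * y ≠ 0 := by
    by_contra! h
    exact (IsPrimeRing.eq_zero_or_eq_zero x y h).elim hx0 hy0
  exact ne_bot_of_mem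
    (TwoSidedIdeal.subset_span ⟨x * r, I.mul_mem_right _ _ hx, y, hy, rfl⟩) hr

theorem inf_ne_bot {I J : TwoSidedIdeal R} (hI : I ≠ ⊥) (hJ : J ≠ ⊥) : I ⊓ J ≠ ⊥ := fun h =>
  idealMul_ne_bot hI hJ
    (le_antisymm (h ▸ le_inf (idealMul_le_left I J) (idealMul_le_right I J)) bot_le)

theorem top_ne_bot : (⊤ : TwoSidedIdeal R) ≠ ⊥ := by
  obtain ⟨x, hx⟩ := exists_ne (0 : R)
  exact ne_bot_of_mem (x := x) trivial hx

end Ideals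

/-- A homomorphism of right `R`-modules `I → R` from a nonzero two-sided ideal `I` (called `dom`) of
`R`. It is recorded by a function on all of `R`, of which only the values on `I` matter: two
such homomorphisms are compared below only on ideals inside their domains. -/
structure PartialHom (R : Type*) [NonUnitalRing R] where
  dom : TwoSidedIdeal R
  dom_ne_bot : dom ≠ ⊥
  toFun : R → R
  map_add : ∀ x ∈ dom, ∀ y ∈ dom, toFun (x + y) = toFun x + toFun y
  map_mul : ∀ x ∈ dom, ∀ r : R, toFun (x * r) = toFun x * r

namespace PartialHom

variable {R : Type*} [NonUnitalRing R]

theorem map_zero (f : PartialHom R) : f.toFun 0 = 0 := by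
  have h := f.map_add 0 f.dom.zero_mem 0 f.dom.zero_mem
  simpa using h

theorem map_neg (f : PartialHom R) {x : R} (hx : x ∈ f.dom) : f.toFun (-x) = -f.toFun x := by
  have h := f.map_add x hx (-x) (f.dom.neg_mem hx)
  rw [add_neg_cancel, f.map_zero] at h
  exact (neg_eq_of_add_eq_zero_right h.symm).symm

theorem map_mem_of_mem_idealMul (g : PartialHom R) (I : TwoSidedIdeal R) {z : R}
    (hz : z ∈ idealMul g.dom I) : g.toFun z ∈ I := by
  refine idealMul_induction (p := fun z => g.toFun z ∈ I) ?_ ?_ ?_ ?_ hz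
  · intro x hx y hy
    rw [g.map_mul x hx]
    exact I.mul_mem_left _ _ hy
  · rw [g.map_zero]; exact I.zero_mem
  · intro x hx y hy h1 h2
    rw [g.map_add x (idealMul_le_left _ _ hx) y (idealMul_le_left _ _ hy)]
    exact I.add_mem h1 h2
  · intro x hx h
    rw [g.map_neg (idealMul_le_left _ _ hx)]
    exact I.neg_mem h

theorem map_mem_of_mem_idealMul_of_le (g : PartialHom R) {V : TwoSidedIdeal R} (hV : V ≤ g.dom)
    (I : TwoSidedIdeal R) {z : R} (hz : z ∈ idealMul V I) : g.toFun z ∈ I := by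
  refine g.map_mem_of_mem_idealMul I (TwoSidedIdeal.span_mono ?_ hz)
  rintro _ ⟨x, hx, y, hy, rfl⟩
  exact ⟨x, hV hx, y, hy, rfl⟩

variable [IsPrimeRing R]

/-- Left multiplication by an element of `R`, as a homomorphism of right modules. -/
def lmul (a : R) : PartialHom R where
  dom := ⊤
  dom_ne_bot := top_ne_bot
  toFun x := a * x
  map_add x _ y _ := mul_add a x y
  map_mul x _ r := (mul_assoc a x r).symm

/-- The identity map. -/
def one : PartialHom R where
  dom := ⊤
  dom_ne_bot := top_ne_bot
  toFun x := x
  map_add _ _ _ _ := rfl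
  map_mul _ _ _ := rfl

/-- The sum, defined on the intersection of the domains. -/
def add (f g : PartialHom R) : PartialHom R where
  dom := f.dom ⊓ g.dom
  dom_ne_bot := inf_ne_bot f.dom_ne_bot g.dom_ne_bot
  toFun x := f.toFun x + g.toFun x
  map_add x hx y hy := by
    rw [TwoSidedIdeal.mem_inf] at hx hy
    rw [f.map_add x hx.1 y hy.1, g.map_add x hx.2 y hy.2]; abel
  map_mul x hx r := by
    rw [TwoSidedIdeal.mem_inf] at hx
    rw [f.map_mul x hx.1, g.map_mul x hx.2, add_mul]

/-- The negative. -/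
def neg (f : PartialHom R) : PartialHom R where
  dom := f.dom
  dom_ne_bot := f.dom_ne_bot
  toFun x := -f.toFun x
  map_add x hx y hy := by rw [f.map_add x hx y hy]; abel
  map_mul x hx r := by rw [f.map_mul x hx, neg_mul]

/-- The composite `f ∘ g`, defined on the product of the domains of `g` and `f`. -/
def comp (f g : PartialHom R) : PartialHom R where
  dom := idealMul g.dom f.dom
  dom_ne_bot := idealMul_ne_bot g.dom_ne_bot f.dom_ne_bot
  toFun x := f.toFun (g.toFun x)
  map_add x hx y hy := by
    rw [g.map_add x (idealMul_le_left _ _ hx) y (idealMul_le_left _ _ hy),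
      f.map_add _ (g.map_mem_of_mem_idealMul _ hx) _ (g.map_mem_of_mem_idealMul _ hy)]
  map_mul x hx r := by
    rw [g.map_mul x (idealMul_le_left _ _ hx), f.map_mul _ (g.map_mem_of_mem_idealMul _ hx)]

/-- Two partial homomorphisms are identified when they agree on some nonzero ideal contained in
both domains. -/
instance setoid (R : Type*) [NonUnitalRing R] [IsPrimeRing R] : Setoid (PartialHom R) where
  r f g := ∃ W : TwoSidedIdeal R, W ≠ ⊥ ∧ W ≤ f.dom ∧ W ≤ g.dom ∧ ∀ x ∈ W, f.toFun x = g.toFun x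
  iseqv :=
    { refl := fun f => ⟨f.dom, f.dom_ne_bot, le_rfl, le_rfl, fun _ _ => rfl⟩
      symm := fun ⟨W, h0, h1, h2, h⟩ => ⟨W, h0, h2, h1, fun x hx => (h x hx).symm⟩
      trans := fun ⟨W, h0, h1, h2, h⟩ ⟨V, k0, k1, k2, k⟩ =>
        ⟨W ⊓ V, inf_ne_bot h0 k0, inf_le_left.trans h1, inf_le_right.trans k2, fun x hx => by
          rw [TwoSidedIdeal.mem_inf] at hx
          exact (h x hx.1).trans (k x hx.2)⟩ }

theorem equiv_of_eq {f g : PartialHom R}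
    (h : ∀ x ∈ f.dom, x ∈ g.dom → f.toFun x = g.toFun x) : f ≈ g :=
  ⟨f.dom ⊓ g.dom, inf_ne_bot f.dom_ne_bot g.dom_ne_bot, inf_le_left, inf_le_right, fun x hx => by
    rw [TwoSidedIdeal.mem_inf] at hx
    exact h x hx.1 hx.2⟩

theorem add_equiv {f f' g g' : PartialHom R} (hf : f ≈ f') (hg : g ≈ g') :
    f.add g ≈ f'.add g' := by
  obtain ⟨W, h0, h1, h2, h⟩ := hf
  obtain ⟨V, k0, k1, k2, k⟩ := hg
  refine ⟨W ⊓ V, inf_ne_bot h0 k0, inf_le_inf h1 k1, inf_le_inf h2 k2, fun x hx => ?_⟩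
  rw [TwoSidedIdeal.mem_inf] at hx
  exact congrArg₂ (· + ·) (h x hx.1) (k x hx.2)

theorem neg_equiv {f f' : PartialHom R} (hf : f ≈ f') : f.neg ≈ f'.neg := by
  obtain ⟨W, h0, h1, h2, h⟩ := hf
  exact ⟨W, h0, h1, h2, fun x hx => congrArg (fun y => -y) (h x hx)⟩

theorem comp_equiv {f f' g g' : PartialHom R} (hf : f ≈ f') (hg : g ≈ g') :
    f.comp g ≈ f'.comp g' := by
  obtain ⟨W, h0, h1, h2, h⟩ := hf
  obtain ⟨V, k0, k1, k2, k⟩ := hg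
  refine ⟨idealMul V W, idealMul_ne_bot k0 h0, TwoSidedIdeal.span_mono ?_,
    TwoSidedIdeal.span_mono ?_, fun x hx => ?_⟩
  · rintro _ ⟨x, hx, y, hy, rfl⟩
    exact ⟨x, k1 hx, y, h1 hy, rfl⟩
  · rintro _ ⟨x, hx, y, hy, rfl⟩
    exact ⟨x, k2 hx, y, h2 hy, rfl⟩
  · change f.toFun (g.toFun x) = f'.toFun (g'.toFun x)
    rw [← k x (idealMul_le_left _ _ hx)]
    exact h _ (g.map_mem_of_mem_idealMul_of_le k1 W hx)

end PartialHom

/-- The Martindale right ring of quotients of a prime ring `R`: the direct limit of the groups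
`Hom(I_R, R_R)` over the nonzero two-sided ideals `I` of `R`. -/
def RightQuotient (R : Type*) [NonUnitalRing R] [IsPrimeRing R] : Type _ :=
  Quotient (PartialHom.setoid R)

namespace RightQuotient

variable {R : Type*} [NonUnitalRing R] [IsPrimeRing R]

/-- Addition is induced by pointwise addition. -/
instance : Add (RightQuotient R) where
  add := Quotient.map₂ PartialHom.add fun _ _ hf _ _ hg => PartialHom.add_equiv hf hg

instance : Zero (RightQuotient R) where
  zero := Quotient.mk _ (PartialHom.lmul 0)

instance : Neg (RightQuotient R) where
  neg := Quotient.map PartialHom.neg fun _ _ hf => PartialHom.neg_equiv hf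

/-- Multiplication is induced by composition. -/
instance : Mul (RightQuotient R) where
  mul := Quotient.map₂ PartialHom.comp fun _ _ hf _ _ hg => PartialHom.comp_equiv hf hg

instance : One (RightQuotient R) where
  one := Quotient.mk _ PartialHom.one

instance : Ring (RightQuotient R) where
  nsmul := nsmulRec
  zsmul := zsmulRec
  add_assoc := by
    rintro ⟨f⟩ ⟨g⟩ ⟨h⟩
    exact Quotient.sound (PartialHom.equiv_of_eq fun x _ _ => add_assoc _ _ _)
  zero_add := by
    rintro ⟨f⟩
    refine Quotient.sound (PartialHom.equiv_of_eq fun x _ _ => ?_)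
    change 0 * x + f.toFun x = f.toFun x
    rw [zero_mul, zero_add]
  add_zero := by
    rintro ⟨f⟩
    refine Quotient.sound (PartialHom.equiv_of_eq fun x _ _ => ?_)
    change f.toFun x + 0 * x = f.toFun x
    rw [zero_mul, add_zero]
  add_comm := by
    rintro ⟨f⟩ ⟨g⟩
    exact Quotient.sound (PartialHom.equiv_of_eq fun x _ _ => add_comm _ _)
  neg_add_cancel := by
    rintro ⟨f⟩
    refine Quotient.sound (PartialHom.equiv_of_eq fun x _ _ => ?_)
    change -f.toFun x + f.toFun x = 0 * x
    rw [zero_mul, neg_add_cancel]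
  mul_assoc := by
    rintro ⟨f⟩ ⟨g⟩ ⟨h⟩
    exact Quotient.sound (PartialHom.equiv_of_eq fun x _ _ => rfl)
  one_mul := by
    rintro ⟨f⟩
    exact Quotient.sound (PartialHom.equiv_of_eq fun x _ _ => rfl)
  mul_one := by
    rintro ⟨f⟩
    exact Quotient.sound (PartialHom.equiv_of_eq fun x _ _ => rfl)
  zero_mul := by
    rintro ⟨f⟩
    refine Quotient.sound (PartialHom.equiv_of_eq fun x _ _ => ?_)
    change 0 * f.toFun x = 0 * x
    rw [zero_mul, zero_mul]
  mul_zero := by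
    rintro ⟨f⟩
    refine Quotient.sound (PartialHom.equiv_of_eq fun x _ _ => ?_)
    change f.toFun (0 * x) = 0 * x
    rw [zero_mul, f.map_zero]
  left_distrib := by
    rintro ⟨f⟩ ⟨g⟩ ⟨h⟩
    refine Quotient.sound (PartialHom.equiv_of_eq fun x _ hx => ?_)
    replace hx := (TwoSidedIdeal.mem_inf R).1 hx
    exact f.map_add _ (g.map_mem_of_mem_idealMul _ hx.1) _ (h.map_mem_of_mem_idealMul _ hx.2)
  right_distrib := by
    rintro ⟨f⟩ ⟨g⟩ ⟨h⟩
    exact Quotient.sound (PartialHom.equiv_of_eq fun x _ _ => rfl)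

/-- The canonical map of `R` into its right ring of quotients; `a` acts by left multiplication. -/
def of (R : Type*) [NonUnitalRing R] [IsPrimeRing R] : R →ₙ+* RightQuotient R where
  toFun a := Quotient.mk _ (PartialHom.lmul a)
  map_zero' := rfl
  map_add' a b := Quotient.sound (PartialHom.equiv_of_eq fun x _ _ => add_mul a b x)
  map_mul' a b := Quotient.sound (PartialHom.equiv_of_eq fun x _ _ => mul_assoc a b x)

end RightQuotient

open RightQuotient in
/-- The Martindale symmetric ring of quotients of a prime ring `R`: the elements `q` of the right
ring of quotients for which `J q ⊆ R` for some nonzero two-sided ideal `J` of `R`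
(that `q I ⊆ R` for some nonzero ideal `I` holds for every `q`). -/
def SymmetricQuotient (R : Type*) [NonUnitalRing R] [IsPrimeRing R] :
    Subring (RightQuotient R) where
  carrier := {q | ∃ J : TwoSidedIdeal R, J ≠ ⊥ ∧ ∀ x ∈ J, ∃ y : R, of R x * q = of R y}
  zero_mem' := ⟨⊤, top_ne_bot, fun x _ => ⟨0, by rw [mul_zero, map_zero]⟩⟩
  one_mem' := ⟨⊤, top_ne_bot, fun x _ => ⟨x, mul_one _⟩⟩
  add_mem' := by
    rintro p q ⟨I, hI, h⟩ ⟨J, hJ, k⟩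
    refine ⟨I ⊓ J, inf_ne_bot hI hJ, fun x hx => ?_⟩
    rw [TwoSidedIdeal.mem_inf] at hx
    obtain ⟨y, hy⟩ := h x hx.1
    obtain ⟨z, hz⟩ := k x hx.2
    exact ⟨y + z, by rw [mul_add, hy, hz, map_add]⟩
  neg_mem' := by
    rintro q ⟨J, hJ, k⟩
    refine ⟨J, hJ, fun x hx => ?_⟩
    obtain ⟨z, hz⟩ := k x hx
    exact ⟨-z, by rw [mul_neg, hz, map_neg]⟩
  mul_mem' := by
    rintro p q ⟨I, hI, h⟩ ⟨J, hJ, k⟩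
    refine ⟨idealMul J I, idealMul_ne_bot hJ hI, fun z hz => ?_⟩
    refine idealMul_induction (p := fun z => ∃ y : R, of R z * (p * q) = of R y)
      ?_ ?_ ?_ ?_ hz
    · intro x hx y hy
      obtain ⟨w, hw⟩ := h y hy
      obtain ⟨v, hv⟩ := k (x * w) (J.mul_mem_right _ _ hx)
      exact ⟨v, by rw [← hv, map_mul, map_mul, ← hw]; simp only [mul_assoc]⟩
    · exact ⟨0, by rw [map_zero, zero_mul]⟩
    · rintro x - y - ⟨a, ha⟩ ⟨b, hb⟩
      exact ⟨a + b, by rw [map_add, map_add, add_mul, ha, hb]⟩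
    · rintro x - ⟨a, ha⟩
      exact ⟨-a, by rw [map_neg, map_neg, neg_mul, ha]⟩

/-- The canonical map of `R` into its symmetric ring of quotients. -/
def toSymmetricQuotient (R : Type*) [NonUnitalRing R] [IsPrimeRing R] :
    R →ₙ+* SymmetricQuotient R where
  toFun a := ⟨RightQuotient.of R a, ⊤, top_ne_bot, fun x _ => ⟨x * a, (map_mul _ x a).symm⟩⟩
  map_zero' := Subtype.ext (map_zero _)
  map_add' a b := Subtype.ext (map_add _ a b)
  map_mul' a b := Subtype.ext (map_mul _ a b)

/-- The extended centroid `C` of `R`: the center of the symmetric ring of quotients. -/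
def extendedCentroid (R : Type*) [NonUnitalRing R] [IsPrimeRing R] :
    Subring (SymmetricQuotient R) :=
  Subring.center (SymmetricQuotient R)

variable {R : Type*} [NonUnitalRing R] [IsPrimeRing R]

open scoped Pointwise in
/-- `KC`: the additive subgroup of the symmetric ring of quotients generated by all products of an
element of `K` and an element of the extended centroid `C`. -/
def mulC (K : AddSubgroup R) : AddSubgroup (SymmetricQuotient R) :=
  K.map (toSymmetricQuotient R : R →+ SymmetricQuotient R) * (extendedCentroid R).toAddSubgroup

/-- `Ca + C`, where `C` is the extended centroid of `R`. -/
def affineC (a : R) : AddSubgroup (SymmetricQuotient R) where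
  carrier := {x | ∃ c ∈ extendedCentroid R, ∃ d ∈ extendedCentroid R,
    x = c * toSymmetricQuotient R a + d}
  zero_mem' := ⟨0, zero_mem _, 0, zero_mem _, by simp⟩
  add_mem' := by
    rintro _ _ ⟨c, hc, d, hd, rfl⟩ ⟨c', hc', d', hd', rfl⟩
    exact ⟨c + c', add_mem hc hc', d + d', add_mem hd hd', by rw [add_mul]; abel⟩
  neg_mem' := by
    rintro _ ⟨c, hc, d, hd, rfl⟩
    exact ⟨-c, neg_mem hc, -d, neg_mem hd, by rw [neg_mul]; abel⟩

end Martindale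

/-!
Let `K`, `L` be Lie ideals and suppose that `V = KL` contains no nonzero ideal. Since
`[k, x] d = k [x, d] - [x, k d]`, an element `x ∈ L ∩ V` satisfies `[k, x] R ⊆ V` and hence commutes
with `K`; likewise `K ∩ V` commutes with `L`. By the Jacobi identity every `c = [k, l]` then
centralizes `V`. If `c` is noncentral, then `V` and its centralizer are commuting noncentral Lie
ideals, so both lie in `Cc + C` by Martindale's lemma, and `1` is a `C`-combination of `c` and some
`[c, r]`. As `kc`, `k[c, r]`, `cl` and `[c, r]l` are in `V`, also `k` and `l` lie in `Cc + C`, so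
they commute. If `c` is central, then `[k, l]l = [kl, l]` lies in `L ∩ V` and commutes with `k`,
whence `c² = 0`. Thus a product of noncentral Lie ideals contains a nonzero ideal unless consecutive
factors commute, and commuting noncentral Lie ideals `K`, `L` satisfy `KC = LC = Ca + C` for each
noncentral `a ∈ K`.
-/

section LieIdeals

open scoped Pointwise

variable {R : Type*} [NonUnitalRing R] {K L : AddSubgroup R}

theorem mul_mem_addSubgroup_mul {a b : R} (ha : a ∈ K) (hb : b ∈ L) : a * b ∈ K * L :=
  AddSubmonoid.mul_mem_mul (M := K.toAddSubmonoid) (N := L.toAddSubmonoid) ha hb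

theorem addSubgroup_mul_le {P : AddSubgroup R} : K * L ≤ P ↔ ∀ a ∈ K, ∀ b ∈ L, a * b ∈ P :=
  AddSubmonoid.mul_le (M := K.toAddSubmonoid) (N := L.toAddSubmonoid) (P := P.toAddSubmonoid)

theorem addSubgroup_mul_assoc (A B D : AddSubgroup R) : A * B * D = A * (B * D) :=
  AddSubgroup.toAddSubmonoid_injective (mul_assoc A.toAddSubmonoid B.toAddSubmonoid _)

theorem mem_center_iff_forall_lie_eq_zero {a : R} : a ∈ Set.center R ↔ ∀ r : R, ⁅a, r⁆ = 0 :=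
  Semigroup.mem_center_iff.trans (forall_congr' fun _ => eq_comm.trans commute_iff_lie_eq)

theorem exists_lie_ne_zero {a : R} (ha : a ∉ Set.center R) : ∃ r : R, ⁅a, r⁆ ≠ 0 := by
  simpa only [mem_center_iff_forall_lie_eq_zero, not_forall] using ha

theorem exists_mem_notMem_center (hL : ¬ IsCentral L) : ∃ a ∈ L, a ∉ Set.center R := by
  simpa only [IsCentral, not_forall, exists_prop] using hL

theorem ne_zero_of_notMem_center {a : R} (ha : a ∉ Set.center R) : a ≠ 0 :=
  fun h => ha (h ▸ Set.zero_mem_center)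

namespace IsLieIdeal

theorem lie_mem_left (hL : IsLieIdeal L) {a : R} (ha : a ∈ L) (r : R) : ⁅a, r⁆ ∈ L :=
  hL a ha r

theorem lie_mem_right (hL : IsLieIdeal L) {a : R} (ha : a ∈ L) (r : R) : ⁅r, a⁆ ∈ L := by
  rw [Ring.lie_def, ← neg_sub]
  exact neg_mem (hL a ha r)

theorem mul (hK : IsLieIdeal K) (hL : IsLieIdeal L) : IsLieIdeal (K * L) := by
  intro v hv r
  refine AddSubmonoid.mul_induction_on (M := K.toAddSubmonoid) (N := L.toAddSubmonoid)
    (C := fun v => v * r - r * v ∈ K * L) hv (fun k hk l hl => ?_) (fun x y hx hy => ?_)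
  · have leibniz : k * l * r - r * (k * l) = k * ⁅l, r⁆ + ⁅k, r⁆ * l := by
      noncomm_ring [Ring.lie_def]
    rw [leibniz]
    exact add_mem (mul_mem_addSubgroup_mul hk (hL.lie_mem_left hl r))
      (mul_mem_addSubgroup_mul (hK.lie_mem_left hk r) hl)
  · rw [add_mul, mul_add, add_sub_add_comm]
    exact add_mem hx hy

theorem lieProd : ∀ {n : ℕ} {K : Fin (n + 1) → AddSubgroup R},
    (∀ j, IsLieIdeal (K j)) → IsLieIdeal (lieProd n K)
  | 0, _, h => h 0
  | _ + 1, _, h => (IsLieIdeal.lieProd fun i => h i.castSucc).mul (h (Fin.last _))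

theorem centralizer (hL : IsLieIdeal L) :
    IsLieIdeal (NonUnitalSubring.centralizer (L : Set R)).toAddSubgroup := by
  intro c hc r l hl
  have h₁ := hc l hl
  have h₂ := hc _ (hL.lie_mem_left hl r)
  linear_combination (norm := noncomm_ring [Ring.lie_def]) h₁ * r - r * h₁ - h₂

/-- The largest two-sided ideal contained in a Lie ideal. It suffices to ask for closure under right
multiplication, because `r x = x r - [x, r]`. -/
def core (hL : IsLieIdeal L) : TwoSidedIdeal R :=
  .mk' {x | x ∈ L ∧ ∀ d, x * d ∈ L} ⟨L.zero_mem, fun d => by rw [zero_mul]; exact L.zero_mem⟩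
    (fun hx hy => ⟨L.add_mem hx.1 hy.1, fun d => by
      rw [add_mul]; exact L.add_mem (hx.2 d) (hy.2 d)⟩)
    (fun hx => ⟨L.neg_mem hx.1, fun d => by rw [neg_mul]; exact L.neg_mem (hx.2 d)⟩)
    (fun {r x} hx => ⟨by
      have := L.sub_mem (hx.2 r) (hL x hx.1 r)
      rwa [sub_sub_cancel] at this, fun d => by
      have := L.sub_mem (hx.2 (d * r)) (hL _ (hx.2 d) r)
      rwa [← mul_assoc, sub_sub_cancel, ← mul_assoc] at this⟩)
    (fun {x r} hx => ⟨hx.2 r, fun d => by rw [mul_assoc]; exact hx.2 _⟩)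

theorem mem_core (hL : IsLieIdeal L) {x : R} : x ∈ hL.core ↔ x ∈ L ∧ ∀ d, x * d ∈ L :=
  TwoSidedIdeal.mem_mk' _ _ _ _ _ _ _

end IsLieIdeal

theorem lieProd_le (S : NonUnitalSubring R) :
    ∀ {n : ℕ} {K : Fin (n + 1) → AddSubgroup R}, (∀ j, K j ≤ S.toAddSubgroup) →
      lieProd n K ≤ S.toAddSubgroup
  | 0, _, h => h 0
  | _ + 1, _, h => addSubgroup_mul_le.2 fun _ ha _ hb =>
      S.mul_mem (lieProd_le S (fun i => h i.castSucc) ha) (h (Fin.last _) hb)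

/-- The additive subgroup `A` contains a nonzero two-sided ideal. -/
def ContainsIdeal (A : AddSubgroup R) : Prop :=
  ∃ I : TwoSidedIdeal R, I ≠ ⊥ ∧ (I : Set R) ⊆ A

end LieIdeals

section PrimeRings

open scoped Pointwise

variable {R : Type*} [NonUnitalRing R] [IsPrimeRing R] {K L : AddSubgroup R}

namespace IsPrimeRing

theorem right_eq_zero {a b : R} (ha : a ≠ 0) (h : ∀ r, a * r * b = 0) : b = 0 :=
  (eq_zero_or_eq_zero a b h).resolve_left ha

theorem left_eq_zero {a b : R} (hb : b ≠ 0) (h : ∀ r, a * r * b = 0) : a = 0 :=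
  (eq_zero_or_eq_zero a b h).resolve_right hb

theorem exists_mul_mul_ne_zero {a b : R} (ha : a ≠ 0) (hb : b ≠ 0) : ∃ r, a * r * b ≠ 0 := by
  by_contra! h
  exact hb (right_eq_zero ha h)

theorem exists_mul_ne_zero {a : R} (ha : a ≠ 0) : ∃ r, a * r ≠ 0 := by
  obtain ⟨r, hr⟩ := exists_mul_mul_ne_zero ha ha
  exact ⟨r * a, by rwa [← mul_assoc]⟩

theorem eq_zero_of_mul_mem_center {x z : R} (hz : z ∈ Set.center R) (hz0 : z ≠ 0)
    (h : x * z = 0) : x = 0 :=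
  left_eq_zero hz0 fun r => by
    rw [mul_assoc, Semigroup.mem_center_iff.1 hz r, ← mul_assoc, h, zero_mul]

theorem eq_zero_of_forall_mul_lie_eq_zero {a x : R} (ha : a ∉ Set.center R)
    (h : ∀ r, x * ⁅a, r⁆ = 0) : x = 0 := by
  obtain ⟨s, hs⟩ := exists_lie_ne_zero ha
  refine left_eq_zero hs fun r => ?_
  linear_combination (norm := noncomm_ring [Ring.lie_def]) h (r * s) - h r * s

theorem mem_center_of_commute_ideal {I : TwoSidedIdeal R} (hI : I ≠ ⊥) {a : R}
    (h : ∀ x ∈ I, Commute a x) : a ∈ Set.center R := by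
  obtain ⟨x, hx, hx0⟩ := Martindale.exists_ne_zero hI
  refine mem_center_iff_forall_lie_eq_zero.2 fun r => left_eq_zero hx0 fun t => ?_
  have h₁ := h _ (I.mul_mem_left (r * t) x hx)
  have h₂ := h _ (I.mul_mem_left t x hx)
  linear_combination (norm := noncomm_ring [Ring.lie_def]) h₁.eq - r * h₂.eq

end IsPrimeRing

theorem not_isCentral_mul (hL : IsLieIdeal L) (hKnc : ¬ IsCentral K) (hLnc : ¬ IsCentral L) :
    ¬ IsCentral (K * L) := by
  intro hV
  obtain ⟨k, hk, hkc⟩ := exists_mem_notMem_center hKnc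
  obtain ⟨l, hl, hlc⟩ := exists_mem_notMem_center hLnc
  refine ne_zero_of_notMem_center hkc
    (IsPrimeRing.eq_zero_of_forall_mul_lie_eq_zero hlc fun s => by_contra fun hz0 => ?_)
  have hz : k * ⁅l, s⁆ ∈ Set.center R :=
    hV _ (mul_mem_addSubgroup_mul hk (hL.lie_mem_left hl s))
  have hkz : k * (k * ⁅l, s⁆) ∈ Set.center R := by
    have hkl := Semigroup.mem_center_iff.1 (hV _ (mul_mem_addSubgroup_mul hk hl)) k
    convert hV _ (mul_mem_addSubgroup_mul hk (hL.lie_mem_left hl (k * s))) using 1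
    linear_combination (norm := noncomm_ring [Ring.lie_def]) hkl * s
  refine hkc (mem_center_iff_forall_lie_eq_zero.2 fun r =>
    IsPrimeRing.eq_zero_of_mul_mem_center hz hz0 ?_)
  have h₁ := Semigroup.mem_center_iff.1 hz r
  have h₂ := Semigroup.mem_center_iff.1 hkz r
  linear_combination (norm := noncomm_ring [Ring.lie_def]) k * h₁ - h₂

theorem not_isCentral_lieProd : ∀ {n : ℕ} {K : Fin (n + 1) → AddSubgroup R},
    (∀ j, IsLieIdeal (K j)) → (∀ j, ¬ IsCentral (K j)) → ¬ IsCentral (lieProd n K)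
  | 0, _, _, hnc => hnc 0
  | _ + 1, _, hLie, hnc => not_isCentral_mul (hLie _)
      (not_isCentral_lieProd (fun i => hLie i.castSucc) fun i => hnc i.castSucc) (hnc _)

theorem IsLieIdeal.containsIdeal_of_mul_mem (hL : IsLieIdeal L) {x : R} (hx : x ≠ 0)
    (h : ∀ d, x * d ∈ L) : ContainsIdeal L := by
  obtain ⟨r, hr⟩ := IsPrimeRing.exists_mul_ne_zero hx
  refine ⟨hL.core, Martindale.ne_bot_of_mem (x := x * r) (hL.mem_core.2 ⟨h r, fun d => ?_⟩) hr,
    fun y hy => (hL.mem_core.1 hy).1⟩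
  rw [mul_assoc]
  exact h _

theorem ContainsIdeal.mul_right (hK : IsLieIdeal K) (hL : IsLieIdeal L) {l : R} (hl : l ∈ L)
    (hl0 : l ≠ 0) : ContainsIdeal K → ContainsIdeal (K * L) := by
  rintro ⟨I, hI, hIK⟩
  obtain ⟨y, hy, hy0⟩ := Martindale.exists_ne_zero hI
  obtain ⟨r, hr⟩ := IsPrimeRing.exists_mul_mul_ne_zero hy0 hl0
  refine (hK.mul hL).containsIdeal_of_mul_mem hr fun d => ?_
  have hd : y * r * l * d = y * r * ⁅l, d⁆ + y * (r * d) * l := by noncomm_ring [Ring.lie_def]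
  rw [hd]
  exact add_mem (mul_mem_addSubgroup_mul (hIK (I.mul_mem_right _ _ hy)) (hL.lie_mem_left hl d))
    (mul_mem_addSubgroup_mul (hIK (I.mul_mem_right _ _ hy)) hl)

theorem ContainsIdeal.mul_left (hK : IsLieIdeal K) (hL : IsLieIdeal L) {k : R} (hk : k ∈ K)
    (hk0 : k ≠ 0) : ContainsIdeal L → ContainsIdeal (K * L) := by
  rintro ⟨I, hI, hIL⟩
  obtain ⟨y, hy, hy0⟩ := Martindale.exists_ne_zero hI
  obtain ⟨r, hr⟩ := IsPrimeRing.exists_mul_mul_ne_zero hk0 hy0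
  refine (hK.mul hL).containsIdeal_of_mul_mem hr fun d => ?_
  rw [mul_assoc, mul_assoc]
  exact mul_mem_addSubgroup_mul hk (hIL (I.mul_mem_left _ _ (I.mul_mem_right _ _ hy)))

theorem not_containsIdeal_lieProd {n : ℕ} {K : Fin (n + 1) → AddSubgroup R} {a : R}
    (ha : a ∉ Set.center R) (h : ∀ j, ∀ x ∈ K j, Commute a x) :
    ¬ ContainsIdeal (lieProd n K) := by
  rintro ⟨I, hI, hIK⟩
  have hle : lieProd n K ≤ (NonUnitalSubring.centralizer {a}).toAddSubgroup :=
    lieProd_le _ fun j x hx => by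
      rintro _ rfl
      exact h j x hx
  exact ha (IsPrimeRing.mem_center_of_commute_ideal hI fun x hx => hle (hIK hx) a rfl)

end PrimeRings

namespace Martindale

variable {R : Type*} [NonUnitalRing R]

section SameRatio

/-- The pairs `(x, y)` and `(u, v)` have the same ratio: once `u ≠ 0` and `x ≠ 0`, there is a
`c ∈ C` with `y = c x` and `v = c u`. -/
def SameRatio (u v x y : R) : Prop :=
  ∀ t, y * t * u = x * t * v

namespace SameRatio

variable {u v x y x' y' : R}

theorem zero : SameRatio u v 0 0 := fun t => by
  simp only [zero_mul]

theorem add (h : SameRatio u v x y) (h' : SameRatio u v x' y') :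
    SameRatio u v (x + x') (y + y') := fun t => by
  simp only [add_mul, h t, h' t]

theorem neg (h : SameRatio u v x y) : SameRatio u v (-x) (-y) := fun t => by
  simp only [neg_mul, h t]

theorem mul_left (r : R) (h : SameRatio u v x y) : SameRatio u v (r * x) (r * y) := fun t => by
  rw [mul_assoc, mul_assoc, ← mul_assoc y, h t, mul_assoc, mul_assoc, mul_assoc]

theorem mul_right (h : SameRatio u v x y) (r : R) : SameRatio u v (x * r) (y * r) := fun t => by
  simpa only [mul_assoc] using h (r * t)

theorem right_unique [IsPrimeRing R] (hu : u ≠ 0) (h : SameRatio u v x y)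
    (h' : SameRatio u v x y') : y = y' :=
  sub_eq_zero.1 (IsPrimeRing.left_eq_zero hu fun t => by
    rw [sub_mul, sub_mul, h t, h' t, sub_self])

end SameRatio

/-- The ideal of all `x` for which `c x` lies in `R`, where `c` is the ratio of `v` to `u`. -/
def ratioDomain (u v : R) : TwoSidedIdeal R :=
  .mk' {x | ∃ y, SameRatio u v x y} ⟨0, .zero⟩
    (fun ⟨_, h⟩ ⟨_, h'⟩ => ⟨_, h.add h'⟩) (fun ⟨_, h⟩ => ⟨_, h.neg⟩)
    (fun ⟨_, h⟩ => ⟨_, h.mul_left _⟩) (fun ⟨_, h⟩ => ⟨_, h.mul_right _⟩)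

theorem mem_ratioDomain {u v x : R} : x ∈ ratioDomain u v ↔ ∃ y, SameRatio u v x y :=
  TwoSidedIdeal.mem_mk' _ _ _ _ _ _ _

end SameRatio

variable [IsPrimeRing R]

local notation "ι" => toSymmetricQuotient R
local notation "C" => extendedCentroid R

section Quotients

theorem RightQuotient.of_injective : Function.Injective (RightQuotient.of R) := by
  intro a b h
  obtain ⟨W, hW, -, -, hab⟩ := Quotient.exact h
  obtain ⟨x, hx, hx0⟩ := exists_ne_zero hW
  refine sub_eq_zero.1 (IsPrimeRing.left_eq_zero hx0 fun r => ?_)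
  have hrx : a * (r * x) = b * (r * x) := hab _ (W.mul_mem_left _ _ hx)
  rw [mul_assoc, sub_mul, hrx, sub_self]

/-- The class of a partial homomorphism in the right ring of quotients. -/
def RightQuotient.mk (f : PartialHom R) : RightQuotient R :=
  Quotient.mk _ f

theorem RightQuotient.mk_mul_of (f : PartialHom R) {x : R} (hx : x ∈ f.dom) :
    RightQuotient.mk f * RightQuotient.of R x = RightQuotient.of R (f.toFun x) :=
  Quotient.sound (PartialHom.equiv_of_eq fun z _ _ => f.map_mul x hx z)

theorem RightQuotient.of_mul_mk (f : PartialHom R)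
    (hf : ∀ r, ∀ x ∈ f.dom, f.toFun (r * x) = r * f.toFun x) {x : R} (hx : x ∈ f.dom) :
    RightQuotient.of R x * RightQuotient.mk f = RightQuotient.of R (f.toFun x) :=
  Quotient.sound (PartialHom.equiv_of_eq fun z hz _ =>
    (hf x z (idealMul_le_left f.dom ⊤ hz)).symm.trans (f.map_mul x hx z))

theorem RightQuotient.eq_zero_of_mul_of {q : RightQuotient R} {I : TwoSidedIdeal R} (hI : I ≠ ⊥)
    (h : ∀ x ∈ I, q * RightQuotient.of R x = 0) : q = 0 := by
  induction q using Quotient.inductionOn with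
  | h f =>
    refine Quotient.sound ⟨f.dom ⊓ I, inf_ne_bot f.dom_ne_bot hI, inf_le_left, le_top,
      fun x hx => ?_⟩
    rw [TwoSidedIdeal.mem_inf] at hx
    have hfx : RightQuotient.of R (f.toFun x) = RightQuotient.of R 0 := by
      rw [← RightQuotient.mk_mul_of f hx.1, map_zero]
      exact h x hx.2
    exact (RightQuotient.of_injective hfx).trans (zero_mul x).symm

theorem toSymmetricQuotient_injective : Function.Injective ι :=
  fun _ _ h => RightQuotient.of_injective (congrArg Subtype.val h)

theorem SymmetricQuotient.eq_zero_of_mul {q : SymmetricQuotient R} {I : TwoSidedIdeal R}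
    (hI : I ≠ ⊥) (h : ∀ x ∈ I, q * ι x = 0) : q = 0 :=
  Subtype.ext (RightQuotient.eq_zero_of_mul_of hI fun x hx => congrArg Subtype.val (h x hx))

theorem SymmetricQuotient.exists_ideal_mul (q : SymmetricQuotient R) :
    ∃ I : TwoSidedIdeal R, I ≠ ⊥ ∧ ∀ x ∈ I, ∃ y, q * ι x = ι y := by
  obtain ⟨q, hq⟩ := q
  induction q using Quotient.inductionOn with
  | h f => exact ⟨f.dom, f.dom_ne_bot, fun x hx =>
      ⟨f.toFun x, Subtype.ext (RightQuotient.mk_mul_of f hx)⟩⟩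

theorem SymmetricQuotient.exists_mul_eq_ne_zero {q : SymmetricQuotient R} (hq : q ≠ 0) :
    ∃ x y, y ≠ 0 ∧ q * ι x = ι y := by
  obtain ⟨I, hI, hqI⟩ := SymmetricQuotient.exists_ideal_mul q
  by_contra! h
  refine hq (eq_zero_of_mul hI fun x hx => ?_)
  obtain ⟨y, hy⟩ := hqI x hx
  rw [hy, by_contra fun hy0 => h x y hy0 hy, map_zero]

theorem map_lie_toSymmetricQuotient (a b : R) : ι ⁅a, b⁆ = ⁅ι a, ι b⁆ := by
  simp only [Ring.lie_def, map_sub, map_mul]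

theorem commute_of_mem_extendedCentroid {c : SymmetricQuotient R} (hc : c ∈ C)
    (q : SymmetricQuotient R) : Commute c q :=
  (Subring.mem_center_iff.1 hc q).symm

theorem mem_center_of_mem_extendedCentroid {a : R} (h : ι a ∈ C) : a ∈ Set.center R :=
  Semigroup.mem_center_iff.2 fun _ =>
    (Commute.of_map toSymmetricQuotient_injective (commute_of_mem_extendedCentroid h _)).eq.symm

theorem mem_extendedCentroid_of_commute {q : SymmetricQuotient R} (h : ∀ r, Commute q (ι r)) :
    q ∈ C := by
  refine Subring.mem_center_iff.2 fun p => sub_eq_zero.1 ?_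
  obtain ⟨I, hI, hp⟩ := SymmetricQuotient.exists_ideal_mul p
  refine SymmetricQuotient.eq_zero_of_mul hI fun x hx => ?_
  obtain ⟨y, hy⟩ := hp x hx
  rw [sub_mul, mul_assoc, (h x).eq, ← mul_assoc, hy, mul_assoc, hy, (h y).eq, sub_self]

theorem exists_mem_extendedCentroid_of_map_mul (f : PartialHom R)
    (hf : ∀ r, ∀ x ∈ f.dom, f.toFun (r * x) = r * f.toFun x) :
    ∃ c ∈ C, ∀ x ∈ f.dom, c * ι x = ι (f.toFun x) := by
  let c : SymmetricQuotient R :=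
    ⟨RightQuotient.mk f, f.dom, f.dom_ne_bot, fun _ hx => ⟨_, RightQuotient.of_mul_mk f hf hx⟩⟩
  have hc : ∀ x ∈ f.dom, c * ι x = ι (f.toFun x) :=
    fun x hx => Subtype.ext (RightQuotient.mk_mul_of f hx)
  refine ⟨c, mem_extendedCentroid_of_commute fun r => sub_eq_zero.1 ?_, hc⟩
  refine SymmetricQuotient.eq_zero_of_mul f.dom_ne_bot fun x hx => ?_
  rw [sub_mul, mul_assoc, mul_assoc, ← map_mul, hc _ (f.dom.mul_mem_left _ _ hx), hc _ hx,
    hf r x hx, map_mul, sub_self]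

end Quotients

section MartindaleLemma

theorem sameRatio_epsilon {u v x : R} (hx : x ∈ ratioDomain u v) :
    SameRatio u v x (Classical.epsilon (SameRatio u v x)) :=
  Classical.epsilon_spec (mem_ratioDomain.1 hx)

/-- Multiplication by the ratio of `v` to `u`, as a homomorphism of right modules. -/
noncomputable def ratioHom {u v : R} (hu : u ≠ 0) (h : ratioDomain u v ≠ ⊥) : PartialHom R where
  dom := ratioDomain u v
  dom_ne_bot := h
  toFun x := Classical.epsilon (SameRatio u v x)
  map_add _ hx _ hy := (sameRatio_epsilon (add_mem hx hy)).right_unique hu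
    ((sameRatio_epsilon hx).add (sameRatio_epsilon hy))
  map_mul _ hx r := (sameRatio_epsilon (TwoSidedIdeal.mul_mem_right _ _ r hx)).right_unique hu
    ((sameRatio_epsilon hx).mul_right r)

theorem exists_mem_extendedCentroid_of_sameRatio {u v x₀ y₀ : R} (hu : u ≠ 0) (hx₀ : x₀ ≠ 0)
    (h₀ : SameRatio u v x₀ y₀) :
    ∃ c ∈ C, ∀ x y, SameRatio u v x y → c * ι x = ι y := by
  obtain ⟨c, hc, hcx⟩ := exists_mem_extendedCentroid_of_map_mul
    (ratioHom hu (ne_bot_of_mem (mem_ratioDomain.2 ⟨y₀, h₀⟩) hx₀)) fun r x hx =>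
      (sameRatio_epsilon (TwoSidedIdeal.mul_mem_left _ r x hx)).right_unique hu
        ((sameRatio_epsilon hx).mul_left r)
  refine ⟨c, hc, fun x y h => ?_⟩
  have hx : x ∈ ratioDomain u v := mem_ratioDomain.2 ⟨y, h⟩
  rw [hcx x hx]
  exact congrArg _ ((sameRatio_epsilon hx).right_unique hu h)

theorem eq_zero_of_mul_toSymmetricQuotient_eq_zero {c : SymmetricQuotient R} (hc : c ∈ C) {x : R}
    (hx : x ≠ 0) (h : c * ι x = 0) : c = 0 := by
  by_contra hc0
  obtain ⟨z, y, hy, hzy⟩ := SymmetricQuotient.exists_mul_eq_ne_zero hc0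
  obtain ⟨t, ht⟩ := IsPrimeRing.exists_mul_mul_ne_zero hy hx
  refine ht (toSymmetricQuotient_injective ?_)
  rw [map_mul, map_mul, ← hzy, mul_assoc, (commute_of_mem_extendedCentroid hc (ι z)).eq, mul_assoc,
    ← mul_assoc c, (commute_of_mem_extendedCentroid hc (ι t)).eq, mul_assoc, h, mul_zero, mul_zero,
    map_zero]

theorem exists_mul_eq_one_of_mem_extendedCentroid {c : SymmetricQuotient R} (hc : c ∈ C)
    (hc0 : c ≠ 0) : ∃ d ∈ C, d * c = 1 := by
  obtain ⟨z, y, hy, hzy⟩ := SymmetricQuotient.exists_mul_eq_ne_zero hc0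
  have hz : z ≠ 0 := by
    rintro rfl
    refine hy (toSymmetricQuotient_injective ?_)
    rw [← hzy, map_zero, mul_zero]
  have hyz : SameRatio y z y z := fun t => toSymmetricQuotient_injective (by
    rw [map_mul, map_mul, map_mul, map_mul, ← hzy, ← mul_assoc,
      ← (commute_of_mem_extendedCentroid hc (ι z * ι t)).eq, ← mul_assoc])
  obtain ⟨d, hd, hdy⟩ := exists_mem_extendedCentroid_of_sameRatio hy hy hyz
  refine ⟨d, hd, sub_eq_zero.1 (eq_zero_of_mul_toSymmetricQuotient_eq_zero
    (sub_mem (mul_mem hd hc) (one_mem _)) hz ?_)⟩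
  rw [sub_mul, mul_assoc, hzy, hdy y z hyz, one_mul, sub_self]

end MartindaleLemma

section AffineC

variable {K L : AddSubgroup R} {a b : R}

theorem mem_affineC {x : SymmetricQuotient R} :
    x ∈ affineC a ↔ ∃ c ∈ C, ∃ d ∈ C, x = c * ι a + d :=
  Iff.rfl

theorem commute_of_mem_affineC {x y : SymmetricQuotient R} (hx : x ∈ affineC a)
    (hy : y ∈ affineC a) : Commute x y := by
  obtain ⟨c, hc, d, hd, rfl⟩ := mem_affineC.1 hx
  obtain ⟨c', hc', d', hd', rfl⟩ := mem_affineC.1 hy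
  have hcomm := fun {e : SymmetricQuotient R} (he : e ∈ C) => commute_of_mem_extendedCentroid he
  exact ((hcomm hc _).mul_left (((hcomm hc' _).symm.mul_right (.refl _)).add_right
    (hcomm hd' _).symm)).add_left (hcomm hd _)

theorem mul_mem_affineC {c x : SymmetricQuotient R} (hc : c ∈ C) (hx : x ∈ affineC a) :
    c * x ∈ affineC a := by
  obtain ⟨d, hd, e, he, rfl⟩ := mem_affineC.1 hx
  exact mem_affineC.2 ⟨c * d, mul_mem hc hd, c * e, mul_mem hc he, by rw [mul_add, mul_assoc]⟩

theorem affineC_le_affineC (h : ι b ∈ affineC a) : affineC b ≤ affineC a := by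
  rintro _ ⟨c, hc, d, hd, rfl⟩
  exact add_mem (mul_mem_affineC hc h) ⟨0, zero_mem _, d, hd, by rw [zero_mul, zero_add]⟩

theorem affineC_eq_affineC (hb : b ∉ Set.center R) (h : ι b ∈ affineC a) :
    affineC b = affineC a := by
  refine le_antisymm (affineC_le_affineC h) (affineC_le_affineC ?_)
  obtain ⟨c, hc, d, hd, hcd⟩ := mem_affineC.1 h
  have hc0 : c ≠ 0 := by
    rintro rfl
    refine hb (mem_center_of_mem_extendedCentroid ?_)
    rwa [hcd, zero_mul, zero_add]
  obtain ⟨e, he, hec⟩ := exists_mul_eq_one_of_mem_extendedCentroid hc hc0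
  refine mem_affineC.2 ⟨e, he, -(e * d), neg_mem (mul_mem he hd), ?_⟩
  rw [hcd, mul_add, ← mul_assoc, hec, one_mul, add_neg_cancel_right]

theorem mem_affineC_of_forall_lie_lie_eq_zero (ha : a ∉ Set.center R)
    (h : ∀ r : R, ⁅a, ⁅b, r⁆⁆ = 0) : ι b ∈ affineC a := by
  obtain ⟨s, hs⟩ := exists_lie_ne_zero ha
  -- Expanding `⁅a, ⁅b, r * t * s⁆⁆ = 0` shows that `⁅a, r⁆ ↦ ⁅b, r⁆` is multiplication by some `c`;
  -- then `b - c a` is central.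
  have hratio : ∀ r, SameRatio ⁅a, s⁆ (-⁅b, s⁆) ⁅a, r⁆ ⁅b, r⁆ := fun r t => by
    linear_combination (norm := noncomm_ring [Ring.lie_def]) h (r * (t * s)) - h r * (t * s)
      - r * h (t * s) - (h (r * t) - h r * t - r * h t) * s
  obtain ⟨c, hc, hcr⟩ := exists_mem_extendedCentroid_of_sameRatio hs hs (hratio s)
  refine mem_affineC.2 ⟨c, hc, ι b - c * ι a, mem_extendedCentroid_of_commute fun r => ?_,
    (add_sub_cancel _ _).symm⟩
  have hr := hcr _ _ (hratio r)
  have hcomm := (commute_of_mem_extendedCentroid hc (ι r)).eq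
  rw [map_lie_toSymmetricQuotient, map_lie_toSymmetricQuotient] at hr
  rw [commute_iff_lie_eq]
  linear_combination (norm := noncomm_ring [Ring.lie_def]) -hr - hcomm * ι a

theorem mem_affineC_of_commute (hL : IsLieIdeal L) (ha : a ∉ Set.center R)
    (h : ∀ l ∈ L, Commute a l) (hb : b ∈ L) : ι b ∈ affineC a :=
  mem_affineC_of_forall_lie_lie_eq_zero ha fun r =>
    commute_iff_lie_eq.1 (h _ (hL.lie_mem_left hb r))

theorem lie_mem_affineC_of_commute (hL : IsLieIdeal L) (hLnc : ¬ IsCentral L)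
    (ha : a ∉ Set.center R) (h : ∀ l ∈ L, Commute a l) (r : R) : ι ⁅a, r⁆ ∈ affineC a := by
  obtain ⟨l, hl, hlc⟩ := exists_mem_notMem_center hLnc
  rw [← affineC_eq_affineC hlc (mem_affineC_of_commute hL ha h hl)]
  exact mem_affineC_of_commute hL.centralizer hlc (fun x hx => hx l hl)
    (hL.centralizer.lie_mem_left (fun l' hl' => (h l' hl').symm) r)

theorem eq_zero_of_mul_self_eq_zero (hb : b * b = 0)
    (h : ∀ r : R, ∃ c ∈ C, ι ⁅b, r⁆ = c * ι b) : b = 0 := by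
  by_contra hb0
  refine hb0 (IsPrimeRing.right_eq_zero hb0 fun r => toSymmetricQuotient_injective ?_)
  obtain ⟨c, hc, hcr⟩ := h r
  have hbrb : b * r * b = -(b * ⁅b, r⁆) := by
    linear_combination (norm := noncomm_ring [Ring.lie_def]) hb * r
  rw [hbrb, map_neg, map_mul, hcr, ← mul_assoc, ← (commute_of_mem_extendedCentroid hc (ι b)).eq,
    mul_assoc, ← map_mul, hb, map_zero, mul_zero, neg_zero]

theorem exists_mul_self_eq_mul (hb : b ∉ Set.center R)
    (h : ∀ r : R, ∃ c ∈ C, ι ⁅b, r⁆ = c * ι b) : ∃ u ∈ C, ι (b * b) = u * ι b := by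
  obtain ⟨s, hs⟩ := exists_lie_ne_zero hb
  obtain ⟨c, hc, hcs⟩ := h s
  obtain ⟨d, hd, hds⟩ := h (b * s)
  have hc0 : c ≠ 0 := by
    rintro rfl
    refine hs (toSymmetricQuotient_injective ?_)
    rw [hcs, zero_mul, map_zero]
  obtain ⟨e, he, hec⟩ := exists_mul_eq_one_of_mem_extendedCentroid hc hc0
  refine ⟨e * d, mul_mem he hd, ?_⟩
  have hbs : ⁅b, b * s⁆ = b * ⁅b, s⁆ := by noncomm_ring [Ring.lie_def]
  rw [mul_assoc, ← hds, hbs, map_mul, map_mul, hcs,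
    ← (commute_of_mem_extendedCentroid hc (ι b)).left_comm, ← mul_assoc, hec, one_mul]

theorem mem_center_of_forall_lie_eq_mul (h : ∀ r : R, ∃ c ∈ C, ι ⁅b, r⁆ = c * ι b) :
    b ∈ Set.center R := by
  by_contra hb
  obtain ⟨u, hu, hub⟩ := exists_mul_self_eq_mul hb h
  obtain ⟨s, hs⟩ := exists_lie_ne_zero hb
  obtain ⟨c, hc, hcs⟩ := h s
  have hbsb : ι (b * ⁅b, s⁆ * b) = 0 := by
    have hexpand : b * ⁅b, s⁆ * b = b * b * (s * b) - b * s * (b * b) := by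
      noncomm_ring [Ring.lie_def]
    rw [hexpand, map_sub, map_mul ι (b * b), map_mul ι (b * s), hub,
      ← (commute_of_mem_extendedCentroid hu (ι (b * s))).left_comm, mul_assoc, ← map_mul, ← map_mul,
      mul_assoc, sub_self]
  have huu : u * u * ι ⁅b, s⁆ = 0 := by
    rw [map_mul, map_mul, hcs, ← (commute_of_mem_extendedCentroid hc (ι b)).left_comm, mul_assoc,
      mul_assoc] at hbsb
    rw [map_mul] at hub
    rw [hcs, ← (commute_of_mem_extendedCentroid hc (u * u)).left_comm, mul_assoc, ← hub,
      ← mul_assoc u, ← hub, mul_assoc, hbsb]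
  have hu0 : u = 0 := by
    by_contra hu0
    obtain ⟨e, -, heu⟩ := exists_mul_eq_one_of_mem_extendedCentroid hu hu0
    have huu := eq_zero_of_mul_toSymmetricQuotient_eq_zero (mul_mem hu hu) hs huu
    exact hu0 (by rw [← one_mul u, ← heu, mul_assoc, huu, mul_zero])
  refine ne_zero_of_notMem_center hb
    (eq_zero_of_mul_self_eq_zero (toSymmetricQuotient_injective ?_) h)
  rw [hub, hu0, zero_mul, map_zero]

theorem exists_lie_add_eq_one (hb : b ∉ Set.center R) (h : ∀ r : R, ι ⁅b, r⁆ ∈ affineC b) :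
    ∃ r : R, ∃ c ∈ C, ∃ d ∈ C, c * ι ⁅b, r⁆ + d * ι b = 1 := by
  obtain ⟨r, hr⟩ : ∃ r : R, ¬ ∃ c ∈ C, ι ⁅b, r⁆ = c * ι b := by
    by_contra! h
    exact hb (mem_center_of_forall_lie_eq_mul h)
  obtain ⟨c, hc, d, hd, hcd⟩ := mem_affineC.1 (h r)
  have hd0 : d ≠ 0 := by
    rintro rfl
    exact hr ⟨c, hc, by rw [hcd, add_zero]⟩
  obtain ⟨e, he, hed⟩ := exists_mul_eq_one_of_mem_extendedCentroid hd hd0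
  refine ⟨r, e, he, -(e * c), neg_mem (mul_mem he hc), ?_⟩
  rw [hcd, mul_add, hed, ← mul_assoc, neg_mul, add_neg_cancel_comm]

end AffineC

section MulC

variable {K L : AddSubgroup R} {a b k : R} {c : SymmetricQuotient R}

theorem mul_mem_mulC (hk : k ∈ K) (hc : c ∈ C) : c * ι k ∈ mulC K := by
  rw [(commute_of_mem_extendedCentroid hc (ι k)).eq]
  exact mul_mem_addSubgroup_mul (AddSubgroup.mem_map_of_mem _ hk) hc

theorem toSymmetricQuotient_mem_mulC (hk : k ∈ K) : ι k ∈ mulC K := by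
  simpa only [one_mul] using mul_mem_mulC hk (one_mem C)

theorem mulC_eq_affineC (hL : IsLieIdeal L) (hb : b ∈ L) (hbc : b ∉ Set.center R)
    (h : ∀ x ∈ L, ι x ∈ affineC b) : mulC L = affineC b := by
  refine le_antisymm (addSubgroup_mul_le.2 ?_) ?_
  · rintro _ ⟨x, hx, rfl⟩ c hc
    rw [← (commute_of_mem_extendedCentroid hc _).eq]
    exact mul_mem_affineC hc (h x hx)
  · rintro _ ⟨u, hu, v, hv, rfl⟩
    obtain ⟨r, c, hc, d, hd, hone⟩ :=
      exists_lie_add_eq_one hbc fun r => h _ (hL.lie_mem_left hb r)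
    rw [← mul_one v, ← hone, mul_add, ← mul_assoc, ← mul_assoc]
    exact add_mem (mul_mem_mulC hb hu) (add_mem
      (mul_mem_mulC (hL.lie_mem_left hb r) (mul_mem hv hc)) (mul_mem_mulC hb (mul_mem hv hd)))

theorem mulC_eq_affineC_of_commute (hL : IsLieIdeal L) (hLnc : ¬ IsCentral L)
    (ha : a ∉ Set.center R) (h : ∀ l ∈ L, Commute a l) : mulC L = affineC a := by
  obtain ⟨b, hb, hbc⟩ := exists_mem_notMem_center hLnc
  have hmem : ∀ l ∈ L, ι l ∈ affineC a := fun l hl => mem_affineC_of_commute hL ha h hl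
  have hba := affineC_eq_affineC hbc (hmem b hb)
  rw [← hba]
  exact mulC_eq_affineC hL hb hbc (by rwa [hba])

theorem mulC_eq_mulC_of_commute (hK : IsLieIdeal K) (hL : IsLieIdeal L) (hKnc : ¬ IsCentral K)
    (hLnc : ¬ IsCentral L) (h : ∀ k ∈ K, ∀ l ∈ L, Commute k l) : mulC K = mulC L := by
  obtain ⟨a, ha, hac⟩ := exists_mem_notMem_center hKnc
  obtain ⟨b, hb, hbc⟩ := exists_mem_notMem_center hLnc
  calc mulC K = affineC b := mulC_eq_affineC_of_commute hK hKnc hbc fun k hk => (h k hk b hb).symm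
    _ = affineC a := affineC_eq_affineC hbc (mem_affineC_of_commute hL hac (h a ha) hb)
    _ = mulC L := (mulC_eq_affineC_of_commute hL hLnc hac (h a ha)).symm

end MulC
end Martindale

section Products

open scoped Pointwise

variable {R : Type*} [NonUnitalRing R] [IsPrimeRing R] {K L : AddSubgroup R} {k l x v : R}

theorem commute_of_mem_right_of_mem_mul (hK : IsLieIdeal K) (hL : IsLieIdeal L)
    (hKL : ¬ ContainsIdeal (K * L)) (hk : k ∈ K) (hxL : x ∈ L) (hxV : x ∈ K * L) :
    Commute k x := by
  by_contra hkx
  refine hKL ((hK.mul hL).containsIdeal_of_mul_mem (mt commute_iff_lie_eq.2 hkx) fun d => ?_)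
  have hd : ⁅k, x⁆ * d = k * ⁅x, d⁆ - ⁅x, k * d⁆ := by noncomm_ring [Ring.lie_def]
  rw [hd]
  exact sub_mem (mul_mem_addSubgroup_mul hk (hL.lie_mem_left hxL d))
    ((hK.mul hL).lie_mem_left hxV _)

theorem commute_of_mem_left_of_mem_mul (hK : IsLieIdeal K) (hL : IsLieIdeal L)
    (hKL : ¬ ContainsIdeal (K * L)) (hl : l ∈ L) (hxK : x ∈ K) (hxV : x ∈ K * L) :
    Commute x l := by
  by_contra hxl
  have hV := hK.mul hL
  refine hKL (hV.containsIdeal_of_mul_mem (mt commute_iff_lie_eq.2 hxl) fun d => ?_)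
  have hd : ⁅x, l⁆ * d = ⁅⁅x, l⁆, d⁆ - ⁅x, d⁆ * l + ⁅x, d * l⁆ := by noncomm_ring [Ring.lie_def]
  rw [hd]
  exact add_mem (sub_mem (hV.lie_mem_left (hV.lie_mem_left hxV l) d)
    (mul_mem_addSubgroup_mul (hK.lie_mem_left hxK d) hl)) (hV.lie_mem_left hxV _)

theorem commute_lie_of_mem_mul (hK : IsLieIdeal K) (hL : IsLieIdeal L)
    (hKL : ¬ ContainsIdeal (K * L)) (hk : k ∈ K) (hl : l ∈ L) (hv : v ∈ K * L) :
    Commute ⁅k, l⁆ v := by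
  have hV := hK.mul hL
  have h₁ := commute_of_mem_right_of_mem_mul hK hL hKL hk (hL.lie_mem_left hl v)
    (hV.lie_mem_right hv l)
  have h₂ := commute_of_mem_left_of_mem_mul hK hL hKL hl (hK.lie_mem_left hk v)
    (hV.lie_mem_right hv k)
  rw [commute_iff_lie_eq]
  linear_combination (norm := noncomm_ring [Ring.lie_def]) h₁.eq + h₂.eq

theorem commute_of_lie_mem_center (hK : IsLieIdeal K) (hL : IsLieIdeal L)
    (hKL : ¬ ContainsIdeal (K * L)) (hk : k ∈ K) (hl : l ∈ L) (hc : ⁅k, l⁆ ∈ Set.center R) :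
    Commute k l := by
  have hcl : ⁅k * l, l⁆ = ⁅k, l⁆ * l := by noncomm_ring [Ring.lie_def]
  have hkcl : Commute k (⁅k, l⁆ * l) := by
    rw [← hcl]
    exact commute_of_mem_right_of_mem_mul hK hL hKL hk (hL.lie_mem_right hl _)
      ((hK.mul hL).lie_mem_left (mul_mem_addSubgroup_mul hk hl) _)
  rw [commute_iff_lie_eq]
  by_contra hc0
  refine hc0 (IsPrimeRing.eq_zero_of_mul_mem_center hc hc0 ?_)
  linear_combination (norm := noncomm_ring [Ring.lie_def])
    hkcl.eq - Semigroup.mem_center_iff.1 hc k * l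

open Martindale in
theorem containsIdeal_mul_of_not_commute (hK : IsLieIdeal K) (hL : IsLieIdeal L) (hk : k ∈ K)
    (hl : l ∈ L) (hkl : ¬ Commute k l) : ContainsIdeal (K * L) := by
  by_contra hKL
  set c := ⁅k, l⁆
  have hcK : c ∈ K := hK.lie_mem_left hk l
  have hcL : c ∈ L := hL.lie_mem_right hl k
  have hc : c ∉ Set.center R := fun hc => hkl (commute_of_lie_mem_center hK hL hKL hk hl hc)
  have hV := hK.mul hL
  have hcV : ∀ v ∈ K * L, Commute c v := fun v hv => commute_lie_of_mem_mul hK hL hKL hk hl hv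
  have hmem : ∀ v ∈ K * L, toSymmetricQuotient R v ∈ affineC c :=
    fun v hv => mem_affineC_of_commute hV hc hcV hv
  have hVnc : ¬ IsCentral (K * L) :=
    not_isCentral_mul hL (fun h => hc (h c hcK)) fun h => hc (h c hcL)
  obtain ⟨r, α, hα, β, hβ, hone⟩ :=
    exists_lie_add_eq_one hc (lie_mem_affineC_of_commute hV hVnc hc hcV)
  have hk' : toSymmetricQuotient R k ∈ affineC c := by
    rw [← mul_one (toSymmetricQuotient R k), ← hone, mul_add,
      ← (commute_of_mem_extendedCentroid hα _).left_comm,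
      ← (commute_of_mem_extendedCentroid hβ _).left_comm, ← map_mul, ← map_mul]
    exact add_mem (mul_mem_affineC hα (hmem _ (mul_mem_addSubgroup_mul hk (hL.lie_mem_left hcL r))))
      (mul_mem_affineC hβ (hmem _ (mul_mem_addSubgroup_mul hk hcL)))
  have hl' : toSymmetricQuotient R l ∈ affineC c := by
    rw [← one_mul (toSymmetricQuotient R l), ← hone, add_mul, mul_assoc, mul_assoc, ← map_mul,
      ← map_mul]
    exact add_mem (mul_mem_affineC hα (hmem _ (mul_mem_addSubgroup_mul (hK.lie_mem_left hcK r) hl)))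
      (mul_mem_affineC hβ (hmem _ (mul_mem_addSubgroup_mul hcK hl)))
  exact hkl (.of_map toSymmetricQuotient_injective (commute_of_mem_affineC hk' hl'))

theorem containsIdeal_lieProd : ∀ {n : ℕ} {K : Fin (n + 1) → AddSubgroup R},
    (∀ j, IsLieIdeal (K j)) → (∀ j, ¬ IsCentral (K j)) → ∀ i : Fin n,
    ∀ k ∈ K i.castSucc, ∀ l ∈ K i.succ, ¬ Commute k l → ContainsIdeal (lieProd n K)
  | 0, _, _, _, i => i.elim0
  | n + 1, K, hLie, hnc, i => by
    intro k hk l hl hkl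
    induction i using Fin.lastCases with
    | last =>
      have hI := containsIdeal_mul_of_not_commute (hLie _) (hLie _) hk hl hkl
      cases n with
      | zero => exact hI
      | succ m =>
        obtain ⟨a, ha, hac⟩ := exists_mem_notMem_center (not_isCentral_lieProd
          (fun i : Fin (m + 1) => hLie i.castSucc.castSucc) fun i => hnc i.castSucc.castSucc)
        rw [lieProd, lieProd, addSubgroup_mul_assoc]
        exact hI.mul_left (.lieProd fun i => hLie i.castSucc.castSucc)
          ((hLie _).mul (hLie _)) ha (ne_zero_of_notMem_center hac)
    | cast j =>
      obtain ⟨a, ha, hac⟩ := exists_mem_notMem_center (hnc (Fin.last _))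
      exact (containsIdeal_lieProd (fun i => hLie i.castSucc) (fun i => hnc i.castSucc) j
        k hk l hl hkl).mul_right (.lieProd fun i => hLie i.castSucc) (hLie _) ha
          (ne_zero_of_notMem_center hac)

end Products

theorem theoremD {R : Type*} [NonUnitalRing R] [IsPrimeRing R] (n : ℕ)
    (K : Fin (n + 2) → AddSubgroup R)
    (hLie : ∀ j, IsLieIdeal (K j)) (hnc : ∀ j, ¬ IsCentral (K j)) :
    (∃ I : TwoSidedIdeal R, I ≠ ⊥ ∧ (I : Set R) ⊆ lieProd (n + 1) K) ↔
      ¬ (∀ j, ∀ a ∈ K 0, a ∉ Set.center R →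
        Martindale.mulC (K 0) = Martindale.mulC (K j) ∧
          Martindale.mulC (K j) = Martindale.affineC a) := by
  constructor
  · intro hI hcond
    obtain ⟨a, ha, hac⟩ := exists_mem_notMem_center (hnc 0)
    have hmem : ∀ j, ∀ y ∈ K j, Martindale.toSymmetricQuotient R y ∈ Martindale.affineC a :=
      fun j y hy => (hcond j a ha hac).2 ▸ Martindale.toSymmetricQuotient_mem_mulC hy
    refine not_containsIdeal_lieProd hac (fun j x hx => ?_) hI
    exact .of_map Martindale.toSymmetricQuotient_injective
      (Martindale.commute_of_mem_affineC (hmem 0 a ha) (hmem j x hx))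
  · intro hcond
    by_contra hI
    have hcomm : ∀ i : Fin (n + 1), ∀ k ∈ K i.castSucc, ∀ l ∈ K i.succ, Commute k l :=
      fun i k hk l hl => by_contra fun h => hI (containsIdeal_lieProd hLie hnc i k hk l hl h)
    have hmulC : ∀ j, Martindale.mulC (K 0) = Martindale.mulC (K j) :=
      Fin.induction rfl fun i ih => ih.trans
        (Martindale.mulC_eq_mulC_of_commute (hLie _) (hLie _) (hnc _) (hnc _) (hcomm i))
    refine hcond fun j a ha hac => ⟨hmulC j, (hmulC j).symm.trans ((hmulC 1).trans ?_)⟩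
    exact Martindale.mulC_eq_affineC_of_commute (hLie _) (hnc _) hac (hcomm 0 a ha)
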